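/- Let $\overline{\mathbb Q}\subset\mathbb C$ be the field of algebraic numbers, and let $H$ denote the non-logarithmic absolute Weil height on $\overline{\mathbb Q}$. A subset $A\subseteq\overline{\mathbb Q}$ has the Northcott property if for each positive real number $X$ there are only finitely many $\alpha\in A$ with $H(\alpha)\le X$. Let $K\subset\overline{\mathbb Q}$ be a number field, let $p_1<p_2<p_3<\cdots$ be an infinite strictly increasing sequence of positive primes, and let $d_1,d_2,d_3,\dots$ be a sequence of positive integers. For each $i$ let $p_i^{1/d_i}\in\overline{\mathbb Q}$ denote any $d_i$-th root of $p_i$. Then the field $K(p_1^{1/d_1},p_2^{1/d_2},p_3^{1/d_3},\dots)$ has the Northcott property if and only if $|p_i^{1/d_i}|\to\infty$ as $i\to\infty$, where $|\cdot|$ denotes the complex modulus. -/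

import Mathlib

/-- The algebraic closure of `ℚ` inside `ℂ`: the field of all algebraic numbers. -/
abbrev QBar : Type := algebraicClosure ℚ ℂ

/-- A set `A` of algebraic numbers has the Northcott property (property (N)) if for each positive
real `X` only finitely many `a ∈ A` satisfy `H(a) ≤ X`, where `H` is the (non-logarithmic)
absolute Weil height, `H(a) = (∏_v max(1, |a|_v)^{d_v})^{1 / [ℚ(a) : ℚ]}` with `v` running over
the places of `ℚ(a)`. -/
def NorthcottProperty (A : Set QBar) : Prop :=
  ∀ X : ℝ, 0 < X → {a : QBar | a ∈ A ∧ NumberField.absMulHeight₁ a ≤ X}.Finite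

/-! Only if: the `α i` are pairwise distinct and `H(α i) = |α i|`, so bounded moduli along
infinitely many indices would violate Northcott.

If: let `F` be a stage of the tower, `a ^ d = p` with `p` unramified in `F`, and `γ = ∑ c_k a^k` in
`F(a)` but not in `F`. Some `σ` fixing `F` moves `γ`. At a place above `p` the nonzero terms `c_k
a^k` have distinct values, because the values of the `c_k` are integral powers of `|p| = |a|^d`.
Hence no term exceeds `γ` or `σγ`, and since the terms with `0 < k < d` never have value 1, one gets
`|σγ - γ| ≤ |a| max(1,|γ|) max(1,|σγ|)` (`FinitePlace.apply_sum_sub_sum_le`). The other finite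
places satisfy the same bound trivially, and the infinite ones cost a factor 2. The product formula
for `σγ - γ` and for `a` then gives `|a| ≤ 2 H(γ)^2` (`norm_le_two_mul_absMulHeight₁_sq`).

For large `i` the prime `p i` is unramified in the stage before `α i`
(`exists_inertia_fixes_adjunctionTower`), so elements of height at most `X` all lie in one fixed
stage, a number field. Unramifiedness is phrased as inertia groups in Galois extensions fixing the
stage. -/

namespace NumberField

open Height

/-! ### Heights under field extension and the absolute height -/

section Extension

variable {K L : Type*} [Field K] [NumberField K] [Field L] [NumberField L]

/-- A product over the infinite places, with multiplicities, is a product over the complex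
embeddings. -/
theorem prod_infinitePlace_pow_mult_eq_prod_embeddings (g : (K → ℝ) → ℝ) :
    ∏ v : InfinitePlace K, g v ^ v.mult = ∏ φ : K →+* ℂ, g (fun x ↦ ‖φ x‖) := by
  classical
  rw [← Finset.prod_fiberwise_of_maps_to (g := InfinitePlace.mk)
    (fun φ _ ↦ Finset.mem_univ (InfinitePlace.mk φ))]
  refine Finset.prod_congr rfl fun v _ ↦ ?_
  rw [← InfinitePlace.card_filter_mk_eq v, ← Finset.prod_const]
  refine Finset.prod_congr (by congr) fun φ hφ ↦ ?_
  rw [Finset.mem_filter] at hφ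
  rw [← hφ.2]
  rfl

/-- A product over the complex embeddings of `L` of a quantity that only depends on the
restriction to `K`. -/
theorem prod_embeddings_comp_algebraMap [Algebra K L] (F : (K →+* ℂ) → ℝ) :
    ∏ φ : L →+* ℂ, F (φ.comp (algebraMap K L)) = (∏ φ : K →+* ℂ, F φ) ^ Module.finrank K L := by
  classical
  rw [← Finset.prod_fiberwise_of_maps_to (g := fun φ : L →+* ℂ ↦ φ.comp (algebraMap K L))
    (fun φ _ ↦ Finset.mem_univ _), ← Finset.prod_pow]
  refine Finset.prod_congr rfl fun ψ _ ↦ ?_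
  rw [Finset.prod_congr rfl (g := fun _ ↦ F ψ)
    (fun φ hφ ↦ by rw [(Finset.mem_filter.mp hφ).2]), Finset.prod_const]
  congr 1
  -- The fibre over `ψ` is the set of `K`-embeddings of `L` into `ℂ`, so it has `[L : K]` elements.
  let : Algebra K ℂ := ψ.toAlgebra
  rw [← AlgHom.card K L ℂ, ← Fintype.card_coe]
  refine Fintype.card_congr ⟨fun φ ↦ ⟨φ.1, fun x ↦ ?_⟩, fun φ ↦ ⟨φ.toRingHom, ?_⟩, ?_, ?_⟩
  · exact RingHom.congr_fun (Finset.mem_filter.mp φ.2).2 x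
  · simp only [Finset.mem_filter, Finset.mem_univ, true_and]
    ext x
    exact φ.commutes x
  · intro φ; rfl
  · intro φ; rfl

/-- The height of a quotient of integers in terms of the complex embeddings and the ideal norm. -/
theorem mulHeight₁_div_mul_absNorm (a b : 𝓞 K) (hb : b ≠ 0) :
    mulHeight₁ ((a : K) / b) * (Ideal.span {a, b}).absNorm =
      ∏ φ : K →+* ℂ, ⨆ i, ‖φ ((![(a : K), b] : Fin 2 → K) i)‖ := by
  have h : (![a, b] : Fin 2 → 𝓞 K) ≠ 0 := fun h ↦ hb (congr_fun h 1)
  have h0 : (![(a : K), b] : Fin 2 → K) ≠ 0 :=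
    fun h ↦ hb (RingOfIntegers.coe_eq_zero_iff.mp (congr_fun h 1))
  have h1 := absNorm_mul_finprod_finitePlace_eq_one h
  rw [mulHeight₁_div_eq_mulHeight, mulHeight_eq h0, mul_assoc]
  -- The finite part of the height is the inverse of the norm of the ideal `(a, b)`.
  have h2 : (∏ᶠ v : FinitePlace K, ⨆ i, v ((![(a : K), b] : Fin 2 → K) i)) *
      (Ideal.span {a, b}).absNorm = 1 := by
    rw [← h1, mul_comm]
    congr 1
    · rw [Matrix.range_cons, Matrix.range_cons, Matrix.range_empty, Set.union_empty]
      rfl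
    · refine finprod_congr fun v ↦ iSup_congr fun i ↦ ?_
      fin_cases i <;> rfl
  rw [h2, mul_one]
  exact prod_infinitePlace_pow_mult_eq_prod_embeddings
    (fun v ↦ ⨆ i, v ((![(a : K), b] : Fin 2 → K) i))

/-- The multiplicative height in an extension is a power of the height in the base field. -/
theorem mulHeight₁_algebraMap [Algebra K L] (x : K) :
    mulHeight₁ (algebraMap K L x) = mulHeight₁ x ^ Module.finrank K L := by
  obtain ⟨a, b, hb, rfl⟩ := IsFractionRing.div_surjective (A := 𝓞 K) x
  have hb : b ≠ 0 := nonZeroDivisors.ne_zero hb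
  have hb' : algebraMap (𝓞 K) (𝓞 L) b ≠ 0 := by simpa using hb
  have hK := mulHeight₁_div_mul_absNorm a b hb
  have hL := mulHeight₁_div_mul_absNorm (algebraMap (𝓞 K) (𝓞 L) a) _ hb'
  have hspan : Ideal.span {algebraMap (𝓞 K) (𝓞 L) a, algebraMap (𝓞 K) (𝓞 L) b} =
      (Ideal.span {a, b}).map (algebraMap (𝓞 K) (𝓞 L)) := by
    rw [Ideal.map_span, Set.image_pair]
  have hrank : Module.finrank (𝓞 K) (𝓞 L) = Module.finrank K L :=
    (IsFractionRing.finrank_eq (𝓞 K) K (𝓞 L) L).symm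
  have hprod : ∏ φ : L →+* ℂ, ⨆ i, ‖φ ((![((algebraMap (𝓞 K) (𝓞 L) a : 𝓞 L) : L),
      (algebraMap (𝓞 K) (𝓞 L) b : 𝓞 L)] : Fin 2 → L) i)‖ =
      (∏ φ : K →+* ℂ, ⨆ i, ‖φ ((![(a : K), b] : Fin 2 → K) i)‖) ^ Module.finrank K L := by
    rw [← prod_embeddings_comp_algebraMap]
    refine Finset.prod_congr rfl fun φ _ ↦ iSup_congr fun i ↦ ?_
    fin_cases i <;> rfl
  -- The norm of the extended ideal is the `[L : K]`-th power of the norm below; this replaces any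
  -- comparison of the finite places of `K` and `L`.
  rw [hprod, ← hK, hspan, Ideal.absNorm_algebraMap, hrank, mul_pow] at hL
  have hpos : ((Ideal.span {a, b}).absNorm : ℝ) ^ Module.finrank K L ≠ 0 := by
    refine pow_ne_zero _ (Nat.cast_ne_zero.mpr ?_)
    rw [Ne, Ideal.absNorm_eq_zero_iff, Ideal.span_eq_bot]
    exact fun h ↦ hb (h b (by simp))
  push_cast at hL
  rw [map_div₀]
  exact mul_right_cancel₀ hpos hL

/-- The absolute height is compatible with the height in any number field. -/
theorem absMulHeight₁_pow_finrank {F : Type*} [Field F] [CharZero F] (f : K →+* F) (x : K) :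
    absMulHeight₁ (f x) ^ Module.finrank ℚ K = mulHeight₁ x := by
  have hx : IsIntegral ℚ (f x) := (Algebra.IsIntegral.isIntegral (R := ℚ) x).map f.toRatAlgHom
  rw [absMulHeight₁, dif_pos hx]
  have : FiniteDimensional ℚ (IntermediateField.adjoin ℚ {f x}) :=
    IntermediateField.adjoin.finiteDimensional hx
  have : NumberField (IntermediateField.adjoin ℚ {f x}) := {}
  have hmem : IntermediateField.adjoin ℚ {f x} ≤ f.toRatAlgHom.fieldRange := by
    rw [IntermediateField.adjoin_simple_le_iff]
    exact ⟨x, rfl⟩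
  let g : IntermediateField.adjoin ℚ {f x} →ₐ[ℚ] K :=
    (AlgEquiv.ofInjectiveField f.toRatAlgHom).symm.toAlgHom.comp
      (IntermediateField.inclusion hmem)
  have hg : g (IntermediateField.AdjoinSimple.gen ℚ (f x)) = x := by
    apply f.injective
    have := congr_arg Subtype.val ((AlgEquiv.ofInjectiveField f.toRatAlgHom).apply_symm_apply
      (IntermediateField.inclusion hmem (IntermediateField.AdjoinSimple.gen ℚ (f x))))
    exact this
  let : Algebra (IntermediateField.adjoin ℚ {f x}) K := g.toRingHom.toAlgebra
  have hK := mulHeight₁_algebraMap (L := K) (IntermediateField.AdjoinSimple.gen ℚ (f x))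
  rw [show algebraMap (IntermediateField.adjoin ℚ {f x}) K
    (IntermediateField.AdjoinSimple.gen ℚ (f x)) = x from hg] at hK
  rw [hK, ← Real.rpow_mul_natCast (mulHeight₁_nonneg _), ← Real.rpow_natCast]
  congr 1
  rw [← Module.finrank_mul_finrank ℚ (IntermediateField.adjoin ℚ {f x}) K]
  have : (Module.finrank ℚ (IntermediateField.adjoin ℚ {f x}) : ℝ) ≠ 0 :=
    Nat.cast_ne_zero.mpr Module.finrank_pos.ne'
  push_cast
  field_simp

/-- The absolute height is nonnegative. -/
theorem absMulHeight₁_nonneg {F : Type*} [Field F] [CharZero F] (x : F) :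
    0 ≤ absMulHeight₁ x := by
  rw [absMulHeight₁]
  split_ifs with hx
  · have : FiniteDimensional ℚ (IntermediateField.adjoin ℚ {x}) :=
      IntermediateField.adjoin.finiteDimensional hx
    have : NumberField (IntermediateField.adjoin ℚ {x}) := {}
    exact Real.rpow_nonneg (mulHeight₁_nonneg _) _
  · exact zero_le_one

/-- The height is invariant under automorphisms. -/
theorem mulHeight₁_algEquiv (σ : K ≃ₐ[ℚ] K) (x : K) : mulHeight₁ (σ x) = mulHeight₁ x := by
  -- Both sides are the same power of the absolute height of `σ x`, seen through the embeddings `id`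
  -- and `σ`.
  rw [← absMulHeight₁_pow_finrank (RingHom.id K) (σ x),
    ← absMulHeight₁_pow_finrank (σ : K →+* K) x]
  rfl

end Extension

/-! ### Inertia and value groups -/

section Unramified

variable {N : Type*} [Field N] [NumberField N] [IsGalois ℚ N]

open IsDedekindDomain

/-- If the inertia group of a prime `Q` of `N` fixes the subfield `E`, then `Q` has the same
ramification index over `ℤ` as over `E`. -/
theorem ramificationIdx'_eq_of_inertia_le (E : IntermediateField ℚ N) (Q : HeightOneSpectrum (𝓞 N))
    (hE : Q.asIdeal.inertia Gal(N/ℚ) ≤ fixingSubgroup Gal(N/ℚ) (E : Set N)) :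
    (Q.under ℤ).asIdeal.ramificationIdx' Q.asIdeal =
      (Q.under (𝓞 E)).asIdeal.ramificationIdx' Q.asIdeal := by
  have : Q.asIdeal.LiesOver (Q.under ℤ).asIdeal := ⟨rfl⟩
  have : Q.asIdeal.LiesOver (Q.under (𝓞 E)).asIdeal := ⟨rfl⟩
  let H := fixingSubgroup Gal(N/ℚ) (E : Set N)
  have : IsGaloisGroup H (𝓞 E) (𝓞 N) := IsGaloisGroup.of_isFractionRing H (𝓞 E) (𝓞 N) E N
  have : Finite (ℤ ⧸ (Q.under ℤ).asIdeal) :=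
    Ring.HasFiniteQuotients.finiteQuotient (Q.under ℤ).ne_bot
  have : Finite (𝓞 E ⧸ (Q.under (𝓞 E)).asIdeal) :=
    Ring.HasFiniteQuotients.finiteQuotient (Q.under (𝓞 E)).ne_bot
  -- Both indices are orders of inertia groups, and the one over `E` is the intersection of the full
  -- one with `H`.
  have h1 := Ideal.card_inertia_eq_ramificationIdxIn (G := Gal(N/ℚ)) (Q.under ℤ).asIdeal Q.asIdeal
  have h2 := Ideal.card_inertia_eq_ramificationIdxIn (G := H) (Q.under (𝓞 E)).asIdeal Q.asIdeal
  rw [Ideal.ramificationIdxIn_eq_ramificationIdx _ Q.asIdeal Gal(N/ℚ)] at h1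
  rw [Ideal.ramificationIdxIn_eq_ramificationIdx _ Q.asIdeal H] at h2
  rw [Ideal.ramificationIdx'_eq_ramificationIdx _ _ (Q.under ℤ).ne_bot,
    Ideal.ramificationIdx'_eq_ramificationIdx _ _ (Q.under (𝓞 E)).ne_bot, ← h1, ← h2]
  exact (Nat.card_congr (Subgroup.subgroupOfEquivOfLe hE).toEquiv).symm

/-- If the inertia group of a finite place `w` of `N` above the rational prime `p` fixes the
subfield `E`, then the value group of `E` at `w` is generated by the value of `p`. -/
theorem FinitePlace.exists_eq_zpow_of_inertia_le (E : IntermediateField ℚ N) {p : ℕ}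
    (hp : p.Prime) (w : FinitePlace N) (hw : w (p : N) < 1)
    (hE : w.maximalIdeal.asIdeal.inertia Gal(N/ℚ) ≤ fixingSubgroup Gal(N/ℚ) (E : Set N))
    {c : N} (hc : c ∈ E) (hc0 : c ≠ 0) : ∃ m : ℤ, w c = w (p : N) ^ m := by
  set Q := w.maximalIdeal with hQ
  have : Q.asIdeal.LiesOver (Q.under ℤ).asIdeal := ⟨rfl⟩
  have : Q.asIdeal.LiesOver (Q.under (𝓞 E)).asIdeal := ⟨rfl⟩
  have hwQ (x : N) : w x = WithZeroMulInt.toNNReal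
      (HeightOneSpectrum.absNorm_ne_zero Q) (Q.valuation N x) := by
    rw [← norm_embedding_eq, norm_embedding']
  have hpQ : (p : ℤ) ∈ (Q.under ℤ).asIdeal := by
    have : (p : 𝓞 N) ∈ Q.asIdeal := by
      rw [← norm_lt_one_iff_mem N, norm_embedding_eq]
      simpa using hw
    simpa [HeightOneSpectrum.under, Ideal.mem_comap] using this
  have hspan : (Q.under ℤ).asIdeal = Ideal.span {(p : ℤ)} := by
    have hmax : (Ideal.span {(p : ℤ)}).IsMaximal :=
      PrincipalIdealRing.isMaximal_of_irreducible (Nat.prime_iff_prime_int.mp hp).irreducible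
    exact (hmax.eq_of_le (Q.under ℤ).isPrime.ne_top
      ((Ideal.span_singleton_le_iff_mem _).mpr hpQ)).symm
  have hvp : Q.valuation N (p : N) =
      WithZero.exp (-1) ^ (Q.under ℤ).asIdeal.ramificationIdx' Q.asIdeal := by
    rw [← (Q.under ℤ).intValuation_singleton (by exact_mod_cast hp.ne_zero) hspan,
      HeightOneSpectrum.intValuation_liesOver, ← HeightOneSpectrum.valuation_of_algebraMap (K := N)]
    simp
  have hvc := HeightOneSpectrum.valuation_liesOver N (Q.under (𝓞 E)) Q (⟨c, hc⟩ : E)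
  rw [← ramificationIdx'_eq_of_inertia_le E Q hE] at hvc
  have hc1 : (Q.under (𝓞 E)).valuation E ⟨c, hc⟩ ≠ 0 := by
    rw [Valuation.ne_zero_iff]
    exact fun h ↦ hc0 (congr_arg Subtype.val h)
  -- With `e` the common ramification index, `c` has value `exp(log)^e` and `p` has value
  -- `exp(-1)^e`.
  refine ⟨-((Q.under (𝓞 E)).valuation E ⟨c, hc⟩).log, ?_⟩
  rw [hwQ, hwQ, ← NNReal.coe_zpow, ← map_zpow₀, hvp]
  congr 2
  change Q.valuation N (algebraMap E N ⟨c, hc⟩) = _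
  rw [← hvc, ← zpow_natCast, ← zpow_natCast, zpow_comm, ← WithZero.exp_zsmul]
  simp [WithZero.exp_log hc1]

end Unramified

/-! ### Local estimates and the product formula -/

section Ultrametric

variable {N : Type*} [Field N] [NumberField N]

/-- If the nonzero values of the terms of a finite sum are pairwise distinct at a finite place,
then no term exceeds the sum. -/
theorem FinitePlace.apply_le_apply_sum (v : FinitePlace N) {s : Finset ℕ} {t : ℕ → N}
    (ht : ∀ j ∈ s, ∀ k ∈ s, t j ≠ 0 → v (t j) = v (t k) → j = k) {k : ℕ} (hk : k ∈ s) :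
    v (t k) ≤ v (∑ i ∈ s, t i) := by
  obtain ⟨k₀, hk₀, hmax⟩ := s.exists_max_image (fun i ↦ v (t i)) ⟨k, hk⟩
  refine (hmax k hk).trans ?_
  by_cases h0 : t k₀ = 0
  · rw [h0, map_zero]
    exact apply_nonneg v _
  · refine (IsNonarchimedean.apply_sum_eq_of_lt (f := v) (FinitePlace.add_le v)
      (fun a ↦ (map_neg_eq_map v a).symm) hk₀ fun j hj hjk ↦ ?_).ge
    refine lt_of_le_of_ne (hmax j hj) fun h ↦ hjk ?_
    exact (ht k₀ hk₀ j hj h0 h.symm).symm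

/-- A bound for the value of a finite sum at a finite place. -/
theorem FinitePlace.apply_sum_le (v : FinitePlace N) {s : Finset ℕ} {t : ℕ → N} {B : ℝ}
    (hB : 0 ≤ B) (ht : ∀ k ∈ s, v (t k) ≤ B) : v (∑ i ∈ s, t i) ≤ B := by
  rcases s.eq_empty_or_nonempty with rfl | hs
  · simpa using hB
  · exact (IsNonarchimedean.apply_sum_le_sup (f := v) (FinitePlace.add_le v) hs).trans
      (Finset.sup'_le _ _ ht)

/-- If `a` has value `|p|^(1/d)` and the coefficients `c k` have values in `|p|^ℤ`, then replacing
`a` by an element `b` of the same value moves `∑ c k * a ^ k` only by a small amount. -/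
theorem FinitePlace.apply_sum_sub_sum_le (v : FinitePlace N) {d : ℕ} {a b : N}
    (ha0 : a ≠ 0) (ha : v a < 1) (hab : v b = v a) {c : ℕ → N}
    (hc : ∀ k, c k ≠ 0 → ∃ m : ℤ, v (c k) = (v a ^ d) ^ m) :
    v (∑ k ∈ Finset.range d, c k * b ^ k - ∑ k ∈ Finset.range d, c k * a ^ k) ≤
      v a * (max (v (∑ k ∈ Finset.range d, c k * a ^ k)) 1 *
        max (v (∑ k ∈ Finset.range d, c k * b ^ k)) 1) := by
  have hapos : 0 < v a := FinitePlace.pos_iff.mpr ha0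
  have hval (k : ℕ) (hk : c k ≠ 0) : ∃ m : ℤ, v (c k * a ^ k) = v a ^ (d * m + k : ℤ) := by
    obtain ⟨m, hm⟩ := hc k hk
    refine ⟨m, ?_⟩
    rw [map_mul, map_pow, hm, zpow_add₀ hapos.ne', zpow_mul, zpow_natCast, zpow_natCast]
  have hvb (k : ℕ) : v (c k * b ^ k) = v (c k * a ^ k) := by
    rw [map_mul, map_mul, map_pow, map_pow, hab]
  have hinj : ∀ j ∈ Finset.range d, ∀ k ∈ Finset.range d, c j ≠ 0 →
      v (c j * a ^ j) = v (c k * a ^ k) → j = k := by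
    intro j hj k hk hj0 h
    have hk0 : c k ≠ 0 := by
      intro hk0
      rw [hk0, zero_mul, map_zero, map_eq_zero] at h
      exact mul_ne_zero hj0 (pow_ne_zero _ ha0) h
    obtain ⟨m, hm⟩ := hval j hj0
    obtain ⟨n, hn⟩ := hval k hk0
    rw [hm, hn] at h
    have h := zpow_right_injective₀ hapos ha.ne h
    -- The exponents are `d * m + j` and `d * n + k` with `j, k < d`, so reduction mod `d` separates
    -- them.
    have h1 := congr_arg (· % (d : ℤ)) h
    simp only [Int.mul_add_emod_self_left] at h1
    rw [Finset.mem_range] at hj hk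
    rw [Int.emod_eq_of_lt (by omega) (by omega), Int.emod_eq_of_lt (by omega) (by omega)] at h1
    exact_mod_cast h1
  set γ := ∑ k ∈ Finset.range d, c k * a ^ k with hγ
  set δ := ∑ k ∈ Finset.range d, c k * b ^ k with hδ
  have hterm : ∀ k ∈ Finset.range d, v (c k * a ^ k) ≤ v γ := fun k hk ↦
    v.apply_le_apply_sum (t := fun k ↦ c k * a ^ k)
      (fun j hj k hk h ↦ hinj j hj k hk (left_ne_zero_of_mul h)) hk
  have hterm' : ∀ k ∈ Finset.range d, v (c k * a ^ k) ≤ v δ := fun k hk ↦ by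
    rw [← hvb]
    refine v.apply_le_apply_sum (t := fun k ↦ c k * b ^ k) (fun j hj k hk h h' ↦ ?_) hk
    rw [hvb, hvb] at h'
    exact hinj j hj k hk (left_ne_zero_of_mul h) h'
  have hdiff (k : ℕ) : v (c k * b ^ k - c k * a ^ k) ≤ v (c k * a ^ k) := by
    rw [sub_eq_add_neg]
    refine (FinitePlace.add_le v _ _).trans (max_le (hvb k).le ?_)
    rw [map_neg_eq_map]
  rw [hδ, hγ, ← Finset.sum_sub_distrib, ← hγ, ← hδ]
  have hB : 0 ≤ v a * (max (v γ) 1 * max (v δ) 1) := by positivity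
  refine v.apply_sum_le hB fun k hk ↦ ?_
  -- The term `k = 0` cancels in the difference; it is the only one whose exponent `d * m + k` could
  -- vanish.
  rcases Nat.eq_zero_or_pos k with rfl | hk0
  · simp
  by_cases hck : c k = 0
  · simp only [hck, zero_mul, sub_self, map_zero]
    exact hB
  refine (hdiff k).trans ?_
  have hone : 1 ≤ max (v γ) 1 * max (v δ) 1 :=
    one_le_mul_of_one_le_of_one_le (le_max_right _ _) (le_max_right _ _)
  obtain ⟨m, hm⟩ := hval k hck
  rw [Finset.mem_range] at hk
  -- The exponent is a nonzero integer. If positive, the term is at most `v a`; if negative, `v a`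
  -- times the term is at least 1, so the term is at most `v a` times its own square.
  rcases le_or_gt (v (c k * a ^ k)) 1 with hle | hgt
  · have hexp : (1 : ℤ) ≤ d * m + k := by
      rw [hm, zpow_le_one_iff_right_of_lt_one₀ hapos ha] at hle
      rcases hle.lt_or_eq with h | h
      · exact h
      · have h1 : (d : ℤ) ∣ k := ⟨-m, by linarith⟩
        have := Nat.le_of_dvd hk0 (Int.natCast_dvd_natCast.mp h1)
        omega
    calc v (c k * a ^ k) ≤ v a ^ (1 : ℤ) := by
          rw [hm]
          exact zpow_le_zpow_right_of_le_one₀ hapos ha.le hexp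
      _ = v a := zpow_one _
      _ ≤ _ := le_mul_of_one_le_right hapos.le hone
  · have hexp : d * m + k ≤ (-1 : ℤ) := by
      rw [hm, one_lt_zpow_iff_right_of_lt_one₀ hapos ha] at hgt
      omega
    have h1 : 1 ≤ v a * v (c k * a ^ k) := by
      rw [hm, ← zpow_one_add₀ hapos.ne']
      exact one_le_zpow_of_nonpos₀ hapos ha.le (by omega)
    have hk' := Finset.mem_range.mpr hk
    calc v (c k * a ^ k) ≤ v (c k * a ^ k) * (v a * v (c k * a ^ k)) :=
          le_mul_of_one_le_right (apply_nonneg v _) h1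
      _ = v a * (v (c k * a ^ k) * v (c k * a ^ k)) := by ring
      _ ≤ _ := by
          gcongr
          · exact (hterm k hk').trans (le_max_left _ _)
          · exact (hterm' k hk').trans (le_max_left _ _)

/-- If two distinct elements `x`, `y` of a number field are close to each other, as measured by
`a`, at all finite places, then their heights are bounded below in terms of `a`. -/
theorem pow_finrank_le_of_apply_sub_le {x y a : N} {r : ℝ} (hr : 0 ≤ r) (hxy : x ≠ y)
    (ha0 : a ≠ 0) (ha : ∀ v : InfinitePlace N, v a = r)
    (h : ∀ v : FinitePlace N, v (y - x) ≤ v a * (max (v x) 1 * max (v y) 1)) :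
    r ^ Module.finrank ℚ N ≤ 2 ^ Module.finrank ℚ N * (mulHeight₁ x * mulHeight₁ y) := by
  have hsub : y - x ≠ 0 := sub_ne_zero.mpr hxy.symm
  have hmax (z : N) : (fun v : FinitePlace N ↦ max (v z) 1).HasFiniteMulSupport := by
    rcases eq_or_ne z 0 with rfl | hz
    · simp [Function.HasFiniteMulSupport]
    · fun_prop (disch := assumption)
  have hprod : (fun v : FinitePlace N ↦ max (v x) 1 * max (v y) 1).HasFiniteMulSupport :=
    (hmax x).mul (hmax y)
  have hfa := FinitePlace.hasFiniteMulSupport ha0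
  have hpa := prod_abs_eq_one ha0
  have hpow (s : ℝ) : ∏ v : InfinitePlace N, s ^ v.mult = s ^ Module.finrank ℚ N := by
    rw [Finset.prod_pow_eq_pow_sum, InfinitePlace.sum_mult_eq]
  -- The finite values of `a` multiply to `r ^ (-[N : ℚ])`, which produces the lower bound.
  simp_rw [ha] at hpa
  rw [hpow] at hpa
  have hfin : ∏ᶠ v : FinitePlace N, v (y - x) ≤ (∏ᶠ v : FinitePlace N, v a) *
      ((∏ᶠ v : FinitePlace N, max (v x) 1) * ∏ᶠ v : FinitePlace N, max (v y) 1) := by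
    rw [← finprod_mul_distrib (hmax x) (hmax y), ← finprod_mul_distrib hfa hprod]
    exact finprod_le_finprod (FinitePlace.hasFiniteMulSupport hsub) (fun v ↦ apply_nonneg v _)
      (hfa.mul hprod) h
  have hinf : ∏ v : InfinitePlace N, v (y - x) ^ v.mult ≤ 2 ^ Module.finrank ℚ N *
      ((∏ v : InfinitePlace N, max (v x) 1 ^ v.mult) *
        ∏ v : InfinitePlace N, max (v y) 1 ^ v.mult) := by
    rw [← hpow, ← Finset.prod_mul_distrib, ← Finset.prod_mul_distrib]
    refine Finset.prod_le_prod (fun v _ ↦ by positivity) fun v _ ↦ ?_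
    rw [← mul_pow, ← mul_pow]
    refine pow_le_pow_left₀ (apply_nonneg v _) ?_ _
    have h1 : v (y - x) ≤ v y + v x := map_sub_le_add v.1 y x
    nlinarith [le_max_left (v x) 1, le_max_right (v x) 1, le_max_left (v y) 1,
      le_max_right (v y) 1]
  have hone := prod_abs_eq_one hsub
  have hfin0 : 0 ≤ ∏ᶠ v : FinitePlace N, v (y - x) := finprod_nonneg fun v ↦ apply_nonneg v _
  have hmain := mul_le_mul hinf hfin hfin0
    (mul_nonneg (by positivity) (mul_nonneg (Finset.prod_nonneg fun v _ ↦ by positivity)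
      (Finset.prod_nonneg fun v _ ↦ by positivity)))
  rw [hone] at hmain
  have hrn : 0 ≤ r ^ Module.finrank ℚ N := pow_nonneg hr _
  calc r ^ Module.finrank ℚ N = r ^ Module.finrank ℚ N * 1 := (mul_one _).symm
    _ ≤ _ := mul_le_mul_of_nonneg_left hmain hrn
    _ = (r ^ Module.finrank ℚ N * ∏ᶠ v : FinitePlace N, v a) *
        (2 ^ Module.finrank ℚ N * (mulHeight₁ x * mulHeight₁ y)) := by
      rw [mulHeight₁_eq, mulHeight₁_eq]
      ring
    _ = _ := by rw [hpa, one_mul]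

end Ultrametric

/-! ### Elements fixed by inertia, and the lower bound in a Galois field -/

section Inertia

variable {N : Type*} [Field N] [NumberField N]

/-- A prime ideal does not contain two coprime natural numbers. -/
theorem not_mem_of_coprime {R : Type*} [CommRing R] {Q : Ideal R} (hQ : Q.IsPrime) {m n : ℕ}
    (h : m.Coprime n) (hm : (m : R) ∈ Q) : (n : R) ∉ Q := by
  intro hn
  have h1 : (1 : R) ∈ Q := by
    have := (Nat.isCoprime_iff_coprime.mpr h)
    obtain ⟨a, b, hab⟩ := this
    have h2 := congr_arg (Int.cast : ℤ → R) hab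
    push_cast at h2
    rw [← h2]
    exact Q.add_mem (Q.mul_mem_left _ hm) (Q.mul_mem_left _ hn)
  exact hQ.ne_top ((Ideal.eq_top_iff_one _).mpr h1)

/-- The inertia group of a prime above `p` fixes the roots of order prime to `p` of the
natural numbers prime to `p`. -/
theorem smul_eq_of_mem_inertia_of_pow_eq {p q e : ℕ} (hpq : p.Coprime q) (hpe : p.Coprime e)
    {Q : Ideal (𝓞 N)} (hQ : Q.IsPrime) (hp : (p : 𝓞 N) ∈ Q) {σ : Gal(N/ℚ)}
    (hσ : σ ∈ Q.inertia Gal(N/ℚ)) {x : 𝓞 N} (hx : x ^ e = q) : σ • x = x := by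
  by_contra hne
  -- If `σ • x ≠ x`, this geometric sum vanishes, while modulo `Q` it equals `e * x ^ (e - 1)`.
  have hmul : (∑ i ∈ Finset.range e, (σ • x) ^ i * x ^ (e - 1 - i)) * (σ • x - x) = 0 := by
    rw [geom_sum₂_mul, ← smul_pow', hx, sub_eq_zero]
    exact map_natCast (MulSemiringAction.toRingHom Gal(N/ℚ) (𝓞 N) σ) q
  have hsum := (mul_eq_zero.mp hmul).resolve_right (sub_ne_zero.mpr hne)
  have hcong : Ideal.Quotient.mk Q (σ • x) = Ideal.Quotient.mk Q x :=
    Ideal.Quotient.eq.mpr (hσ x)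
  have hmem : (e : 𝓞 N) * x ^ (e - 1) ∈ Q := by
    rw [← Ideal.Quotient.eq_zero_iff_mem, map_mul, map_pow, map_natCast, ← geom_sum₂_self,
      ← map_zero (Ideal.Quotient.mk Q), ← hsum]
    simp [hcong]
  rcases hQ.mem_or_mem hmem with h | h
  · exact not_mem_of_coprime hQ hpe hp h
  · have hxQ : x ∈ Q := hQ.mem_of_pow_mem _ h
    refine not_mem_of_coprime hQ hpq hp ?_
    rw [← hx]
    refine Q.pow_mem_of_mem hxQ e (Nat.pos_of_ne_zero ?_)
    rintro rfl
    exact hne (by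
      have := not_mem_of_coprime hQ hpe hp
      simp at this)

/-- The inertia group of a prime of `N` fixes the integer `x` of `N` if the residue characteristic
does not divide a multiple `n` of `f'(x)`, where `f` is a monic integral polynomial with root
`x`. -/
theorem smul_eq_of_mem_inertia_of_dvd {p n : ℕ} (hp' : p.Prime) (hpn : ¬ p ∣ n) {Q : Ideal (𝓞 N)}
    (hQ : Q.IsPrime) (hp : (p : 𝓞 N) ∈ Q) {σ : Gal(N/ℚ)} (hσ : σ ∈ Q.inertia Gal(N/ℚ))
    {x : 𝓞 N} {f : Polynomial ℤ} (hx : Polynomial.aeval x f = 0)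
    (hn : Polynomial.aeval x (Polynomial.derivative f) ∣ (n : 𝓞 N)) : σ • x = x := by
  by_contra hne
  set g := f.map (algebraMap ℤ (𝓞 N)) with hg
  have hgx : g.IsRoot x := by
    rw [Polynomial.IsRoot, hg, Polynomial.eval_map_algebraMap, hx]
  -- Write `f = (X - x) h`: then `h (σ • x) = 0` and `h x = f' x`, so `σ • x ≡ x` forces `f' x` into
  -- `Q`.
  obtain ⟨h, hh⟩ := Polynomial.dvd_iff_isRoot.mpr hgx
  have hσx : g.eval (σ • x) = 0 := by
    rw [hg, Polynomial.eval_map_algebraMap]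
    have := Polynomial.aeval_algHom_apply
      ((MulSemiringAction.toRingHom Gal(N/ℚ) (𝓞 N) σ).toIntAlgHom) x f
    rw [hx, map_zero] at this
    exact this
  have h1 : h.eval (σ • x) = 0 := by
    rw [hh, Polynomial.eval_mul, mul_eq_zero] at hσx
    refine hσx.resolve_left ?_
    simpa [sub_eq_zero] using hne
  have h2 : h.eval x = Polynomial.aeval x (Polynomial.derivative f) := by
    have := congr_arg (fun P ↦ Polynomial.eval x (Polynomial.derivative P)) hh
    simp only [Polynomial.derivative_mul, hg, Polynomial.derivative_map] at this
    rw [Polynomial.eval_map_algebraMap] at this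
    simpa using this.symm
  have h3 : h.eval x ∈ Q := by
    have h4 := Polynomial.sub_dvd_eval_sub (σ • x) x h
    rw [h1, zero_sub, dvd_neg] at h4
    exact Q.mem_of_dvd h4 (hσ x)
  rw [h2] at h3
  exact not_mem_of_coprime hQ ((Nat.Prime.coprime_iff_not_dvd hp').mpr hpn) hp (Q.mem_of_dvd hn h3)

/-- For every number field `K`, all but finitely many rational primes `p` have the property that
the inertia groups above `p` in any Galois extension of `ℚ` containing `K` fix `K`. -/
theorem exists_inertia_fixes (K : Type) [Field K] [NumberField K] :
    ∃ B : ℕ, ∀ (N : Type) [Field N] [NumberField N] [IsGalois ℚ N] [Algebra K N] (p : ℕ),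
      p.Prime → B < p → ∀ Q : Ideal (𝓞 N), Q.IsPrime → (p : 𝓞 N) ∈ Q →
      ∀ σ ∈ Q.inertia Gal(N/ℚ), ∀ x : K, σ (algebraMap K N x) = algebraMap K N x := by
  have hex (x : 𝓞 K) : ∃ (f : Polynomial ℤ) (n : ℕ), n ≠ 0 ∧ Polynomial.aeval x f = 0 ∧
      Polynomial.aeval x (Polynomial.derivative f) ∣ (n : 𝓞 K) := by
    have hint : IsIntegral ℤ x := Algebra.IsIntegral.isIntegral x
    have hne : Polynomial.aeval x (Polynomial.derivative (minpoly ℤ x)) ≠ 0 := by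
      intro h0
      have hdvd := minpoly.isIntegrallyClosed_dvd hint h0
      have hder : Polynomial.derivative (minpoly ℤ x) ≠ 0 := fun h ↦
        (minpoly.natDegree_pos hint).ne' (Polynomial.derivative_eq_zero.mp h)
      have := Polynomial.degree_le_of_dvd hdvd hder
      exact absurd (Polynomial.degree_derivative_lt (minpoly.ne_zero hint)) (not_lt.mpr this)
    -- An ideal contains its norm, so `f' x` divides the norm of the ideal it generates.
    refine ⟨minpoly ℤ x, Ideal.absNorm (Ideal.span {Polynomial.aeval x
      (Polynomial.derivative (minpoly ℤ x))}), ?_, minpoly.aeval ℤ x, ?_⟩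
    · simpa [Ideal.absNorm_eq_zero_iff] using hne
    · exact Ideal.mem_span_singleton.mp (Ideal.absNorm_mem _)
  choose f n hn hf hdvd using hex
  -- A prime above this sum exceeds, hence does not divide, each positive `n` of the integral basis.
  -- The bound does not involve `N`.
  refine ⟨∑ i, n (RingOfIntegers.basis K i), ?_⟩
  intro N _ _ _ _ p hp hB Q hQ hpQ σ hσ x
  have hfix (i) : σ (algebraMap K N (integralBasis K i)) = algebraMap K N (integralBasis K i) := by
    have hlt : n (RingOfIntegers.basis K i) < p :=
      (Finset.single_le_sum (f := fun i ↦ n (RingOfIntegers.basis K i))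
        (fun _ _ ↦ Nat.zero_le _) (Finset.mem_univ i)).trans_lt hB
    have h := smul_eq_of_mem_inertia_of_dvd hp
      (Nat.not_dvd_of_pos_of_lt (Nat.pos_of_ne_zero (hn (RingOfIntegers.basis K i))) hlt) hQ hpQ hσ
      (x := algebraMap (𝓞 K) (𝓞 N) (RingOfIntegers.basis K i))
      (f := f (RingOfIntegers.basis K i)) ?_ ?_
    · have h1 := congr_arg (algebraMap (𝓞 N) N) h
      rw [integralBasis_apply]
      exact h1
    · rw [Polynomial.aeval_algebraMap_apply, hf, map_zero]
    · rw [Polynomial.aeval_algebraMap_apply]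
      simpa using map_dvd (algebraMap (𝓞 K) (𝓞 N)) (hdvd (RingOfIntegers.basis K i))
  have heq : (σ : N →ₐ[ℚ] N).comp (Algebra.algHom ℚ K N) = Algebra.algHom ℚ K N := by
    have : ((σ : N →ₐ[ℚ] N).comp (Algebra.algHom ℚ K N)).toLinearMap =
        (Algebra.algHom ℚ K N).toLinearMap :=
      (integralBasis K).ext fun i ↦ hfix i
    exact AlgHom.toLinearMap_injective this
  exact AlgHom.congr_fun heq x

/-- A lower bound for the height of an element of a field `E(a)`, with `a` a `d`-th root of a
prime that is unramified in `E`, that does not belong to `E`. -/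
theorem pow_finrank_le_mulHeight₁ [IsGalois ℚ N] (E : IntermediateField ℚ N) {p d : ℕ} (hp : p.Prime)
    (hd : 0 < d) {a : N} (ha : a ^ d = p) {r : ℝ} (hr : 0 ≤ r) (hrd : r ^ d = p)
    (hE : ∀ w : FinitePlace N, w (p : N) < 1 →
      w.maximalIdeal.asIdeal.inertia Gal(N/ℚ) ≤ fixingSubgroup Gal(N/ℚ) (E : Set N))
    {c : ℕ → N} (hc : ∀ k, c k ∈ E)
    (hx : ∑ k ∈ Finset.range d, c k * a ^ k ∉ E) :
    r ^ Module.finrank ℚ N ≤ 2 ^ Module.finrank ℚ N *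
      mulHeight₁ (∑ k ∈ Finset.range d, c k * a ^ k) ^ 2 := by
  set x := ∑ k ∈ Finset.range d, c k * a ^ k with hxdef
  obtain ⟨σ, hσE, hσx⟩ : ∃ σ ∈ E.fixingSubgroup, σ x ≠ x := by
    by_contra! h
    rw [← IsGalois.fixedField_fixingSubgroup E] at hx
    exact hx fun σ ↦ h σ σ.2
  have hσc (k : ℕ) : σ (c k) = c k := (mem_fixingSubgroup_iff _).mp hσE (c k) (hc k)
  have hσx' : σ x = ∑ k ∈ Finset.range d, c k * σ a ^ k := by
    simp [hxdef, map_sum, hσc]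
  have ha0 : a ≠ 0 := by
    rintro rfl
    rw [zero_pow hd.ne'] at ha
    exact hp.ne_zero (by exact_mod_cast ha.symm)
  have hσa : (σ a) ^ d = p := by rw [← map_pow, ha, map_natCast]
  have key := pow_finrank_le_of_apply_sub_le hr hσx.symm ha0 (fun v ↦ ?_) fun v ↦ ?_
  · rwa [mulHeight₁_algEquiv, ← sq] at key
  · refine (pow_left_inj₀ (apply_nonneg v _) hr hd.ne').mp ?_
    rw [← map_pow, ha, hrd, ← InfinitePlace.norm_embedding_eq, map_natCast, Complex.norm_natCast]
  · have hva : v a ^ d = v (p : N) := by rw [← map_pow, ha]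
    have hvσa : v (σ a) = v a := by
      refine (pow_left_inj₀ (apply_nonneg v _) (apply_nonneg v _) hd.ne').mp ?_
      rw [← map_pow, hσa, hva]
    -- Above `p` the local estimate applies; elsewhere `v a ≥ 1` and the ultrametric inequality
    -- suffices.
    rcases lt_or_ge (v (p : N)) 1 with hvp | hvp
    · have hva1 : v a < 1 := by
        by_contra! h
        exact absurd (one_le_pow₀ h (n := d)) (by rw [hva]; exact not_le.mpr hvp)
      rw [hσx']
      refine v.apply_sum_sub_sum_le ha0 hva1 hvσa fun k hk ↦ ?_
      rw [hva]
      exact v.exists_eq_zpow_of_inertia_le E hp hvp (hE v hvp) (hc k) hk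
    · have hva1 : 1 ≤ v a := by
        by_contra! h
        exact absurd (pow_lt_one₀ (apply_nonneg v a) h hd.ne') (by rw [hva]; exact not_lt.mpr hvp)
      have h1 : v (σ x - x) ≤ max (v (σ x)) (v x) := by
        rw [sub_eq_add_neg, ← map_neg_eq_map v x]
        exact FinitePlace.add_le v _ _
      have h2 : max (v (σ x)) (v x) ≤ max (v x) 1 * max (v (σ x)) 1 :=
        max_le ((le_max_left _ _).trans (le_mul_of_one_le_left (by positivity) (le_max_right _ _)))
          ((le_max_left _ _).trans (le_mul_of_one_le_right (by positivity) (le_max_right _ _)))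
      exact h1.trans (h2.trans (le_mul_of_one_le_left (by positivity) hva1))

end Inertia

end NumberField

/-! ### The tower over `K` and its inertia -/

open NumberField IntermediateField

instance : IsAlgClosure ℚ QBar := algebraicClosure.isAlgClosure ℚ ℂ

instance : Algebra.IsAlgebraic ℚ QBar := IsAlgClosure.isAlgebraic

instance : Normal ℚ QBar := IsAlgClosure.normal ℚ QBar

/-- The tower of fields obtained from `K` by adjoining the terms of the sequence `α` one after the
other. -/
noncomputable def adjunctionTower (K : IntermediateField ℚ QBar) (α : ℕ → QBar) :
    ℕ → IntermediateField ℚ QBar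
  | 0 => K
  | i + 1 => adjunctionTower K α i ⊔ adjoin ℚ {α i}

namespace adjunctionTower

variable (K : IntermediateField ℚ QBar) (α : ℕ → QBar)

theorem monotone : Monotone (adjunctionTower K α) :=
  monotone_nat_of_le_succ fun _ ↦ le_sup_left

theorem mem_succ (i : ℕ) : α i ∈ adjunctionTower K α (i + 1) :=
  (le_sup_right : _ ≤ adjunctionTower K α i ⊔ adjoin ℚ {α i})
    (mem_adjoin_simple_self ℚ (α i))

instance [NumberField K] (i : ℕ) : NumberField (adjunctionTower K α i) := by
  have : FiniteDimensional ℚ (adjunctionTower K α i) := by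
    induction i with
    | zero => exact inferInstanceAs (FiniteDimensional ℚ K)
    | succ i ih =>
      have : FiniteDimensional ℚ (adjoin ℚ {α i}) :=
        adjoin.finiteDimensional (Algebra.IsIntegral.isIntegral (α i))
      exact finiteDimensional_sup (adjunctionTower K α i) (adjoin ℚ {α i})
  exact {}

theorem exists_mem {x : QBar} (hx : x ∈ adjoin K (Set.range α)) :
    ∃ i, x ∈ adjunctionTower K α i := by
  have mono {i j : ℕ} (h : i ≤ j) {y : QBar} (hy : y ∈ adjunctionTower K α i) :
      y ∈ adjunctionTower K α j := monotone K α h hy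
  induction hx using adjoin_induction with
  | mem x hx =>
    obtain ⟨i, rfl⟩ := hx
    exact ⟨i + 1, mem_succ K α i⟩
  | algebraMap x => exact ⟨0, x.2⟩
  | add x y _ _ hx hy =>
    obtain ⟨i, hi⟩ := hx
    obtain ⟨j, hj⟩ := hy
    exact ⟨max i j, add_mem (mono (le_max_left i j) hi) (mono (le_max_right i j) hj)⟩
  | inv x _ hx =>
    obtain ⟨i, hi⟩ := hx
    exact ⟨i, inv_mem hi⟩
  | mul x y _ _ hx hy =>
    obtain ⟨i, hi⟩ := hx
    obtain ⟨j, hj⟩ := hy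
    exact ⟨max i j, mul_mem (mono (le_max_left i j) hi) (mono (le_max_right i j) hj)⟩

end adjunctionTower

/-- An automorphism of `N` that fixes the subfield `F` and the element `a` fixes `F(a)`. -/
theorem forall_mem_sup_adjoin_fixed {F N : IntermediateField ℚ QBar} (σ : Gal(N/ℚ)) {a : QBar}
    (hF : ∀ x (hx : x ∈ N), x ∈ F → σ ⟨x, hx⟩ = ⟨x, hx⟩) (haN : a ∈ N) (hFN : F ≤ N)
    (ha : σ ⟨a, haN⟩ = ⟨a, haN⟩) (x : QBar) (hx : x ∈ N) (hxF : x ∈ F ⊔ adjoin ℚ {a}) :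
    σ ⟨x, hx⟩ = ⟨x, hx⟩ := by
  -- The fixed field of `σ`, moved into `QBar` so that it can be compared with `F(a)`.
  let T : IntermediateField ℚ QBar := (fixedField (Subgroup.zpowers σ)).map N.val
  have hT {y : QBar} (hy : y ∈ N) (h : σ ⟨y, hy⟩ = ⟨y, hy⟩) : y ∈ T := by
    refine ⟨⟨y, hy⟩, ?_, rfl⟩
    have hle : Subgroup.zpowers σ ≤ MulAction.stabilizer Gal(N/ℚ) (⟨y, hy⟩ : N) := by
      rw [Subgroup.zpowers_le]
      exact h
    exact fun τ ↦ hle τ.2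
  have hle : F ⊔ adjoin ℚ {a} ≤ T :=
    sup_le (fun y hy ↦ hT (hFN hy) (hF y _ hy)) (adjoin_simple_le_iff.mpr (hT haN ha))
  obtain ⟨y, hy, rfl⟩ := hle hxF
  exact hy ⟨σ, Subgroup.mem_zpowers σ⟩

/-- Inertia groups above a prime `q` that is large compared to `K` and prime to the `p j` and to
the `d j` fix the extension of `K` generated by the `d j`-th roots of the `p j`. -/
theorem exists_inertia_fixes_adjunctionTower (K : IntermediateField ℚ QBar) [NumberField K]
    {p d : ℕ → ℕ} {α : ℕ → QBar} (hd : ∀ i, 0 < d i) (hα : ∀ i, α i ^ d i = (p i : QBar)) :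
    ∃ B : ℕ, ∀ (q : ℕ), q.Prime → B < q →
      ∀ i, (∀ j < i, q.Coprime (p j) ∧ q.Coprime (d j)) →
      ∀ (N : IntermediateField ℚ QBar) [NumberField N] [IsGalois ℚ N], adjunctionTower K α i ≤ N →
      ∀ Q : Ideal (𝓞 N), Q.IsPrime → (q : 𝓞 N) ∈ Q → ∀ σ ∈ Q.inertia Gal(N/ℚ),
      ∀ x (hx : x ∈ N), x ∈ adjunctionTower K α i → σ ⟨x, hx⟩ = ⟨x, hx⟩ := by
  obtain ⟨B, hB⟩ := exists_inertia_fixes K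
  -- The bound for `K` serves every stage: each new root only excludes the primes dividing `p i` or
  -- `d i`.
  refine ⟨B, fun q hq hBq i ↦ ?_⟩
  induction i with
  | zero =>
    intro _ N _ _ hKN Q hQ hqQ σ hσ x hx hxK
    let : Algebra K N := (inclusion hKN).toRingHom.toAlgebra
    exact hB N q hq hBq Q hQ hqQ σ hσ ⟨x, hxK⟩
  | succ i ih =>
    intro hcop N _ _ hN Q hQ hqQ σ hσ
    have hFN := (adjunctionTower.monotone K α i.le_succ).trans hN
    have haN := hN (adjunctionTower.mem_succ K α i)
    refine forall_mem_sup_adjoin_fixed σ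
      (ih (fun j hj ↦ hcop j (hj.trans i.lt_succ_self)) N hFN Q hQ hqQ σ hσ) haN hFN ?_
    have hpow : (⟨α i, haN⟩ : N) ^ d i = p i := Subtype.ext (hα i)
    have hint : IsIntegral ℤ (⟨α i, haN⟩ : N) :=
      IsIntegral.of_pow (hd i) (hpow ▸ isIntegral_algebraMap (R := ℤ) (x := (p i : ℤ)))
    obtain ⟨y, hy⟩ : ∃ y : 𝓞 N, algebraMap (𝓞 N) N y = ⟨α i, haN⟩ := ⟨⟨_, hint⟩, rfl⟩
    have hyd : y ^ d i = p i := 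
      RingOfIntegers.coe_injective (by rw [map_pow, hy, hpow, map_natCast])
    have h := smul_eq_of_mem_inertia_of_pow_eq (hcop i i.lt_succ_self).1
      (hcop i i.lt_succ_self).2 hQ hqQ hσ hyd
    rw [← hy]
    exact congr_arg (algebraMap (𝓞 N) N) h

/-! ### Elements of `F(a)` and their absolute heights -/

/-- An element of `F[a]`, where `a` is a root of `X ^ d - p`, is a polynomial in `a` of degree
less than `d`. -/
theorem exists_eq_sum_of_mem_adjoin {F L : Type*} [Field F] [Field L] [Algebra F L] {a : L}
    {p d : ℕ} (hd : 0 < d) (ha : a ^ d = p) {γ : L} (hγ : γ ∈ Algebra.adjoin F {a}) :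
    ∃ c : ℕ → F, γ = ∑ k ∈ Finset.range d, algebraMap F L (c k) * a ^ k := by
  obtain ⟨g, rfl⟩ := Algebra.adjoin_mem_exists_aeval F a hγ
  let f : Polynomial F := Polynomial.X ^ d - Polynomial.C (p : F)
  have hf : f.Monic := Polynomial.monic_X_pow_sub_C _ hd.ne'
  have hdeg : f.natDegree = d := Polynomial.natDegree_X_pow_sub_C
  have hfa : Polynomial.aeval a f = 0 := by simp [f, ha]
  -- Division by the monic `X ^ d - p` gives the coefficients; its irreducibility plays no role.
  refine ⟨(g %ₘ f).coeff, ?_⟩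
  have hlt : (g %ₘ f).natDegree < d := by
    rw [← hdeg]
    refine Polynomial.natDegree_modByMonic_lt g hf fun h ↦ hd.ne' ?_
    rw [← hdeg, h, Polynomial.natDegree_one]
  rw [← Polynomial.aeval_modByMonic_eq_self_of_root hfa, Polynomial.aeval_eq_sum_range' hlt]
  exact Finset.sum_congr rfl fun k _ ↦ Algebra.smul_def _ _

/-- An element of `F(a)`, where `a` is a root of `X ^ d - p`, is a polynomial in `a` of degree
less than `d`. -/
theorem exists_eq_sum_of_mem_sup_adjoin {F : IntermediateField ℚ QBar} {a : QBar} {p d : ℕ}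
    (hd : 0 < d) (ha : a ^ d = (p : QBar)) {γ : QBar} (hγ : γ ∈ F ⊔ adjoin ℚ {a}) :
    ∃ c : ℕ → F, γ = ∑ k ∈ Finset.range d, (c k : QBar) * a ^ k := by
  have hmem : γ ∈ adjoin F {a} := by
    have hle : F ⊔ adjoin ℚ {a} ≤ (adjoin F {a}).restrictScalars ℚ := by
      refine sup_le (fun y hy ↦ (adjoin F {a}).algebraMap_mem ⟨y, hy⟩) ?_
      rw [adjoin_simple_le_iff]
      exact mem_adjoin_simple_self F a
    exact hle hγ
  have halg : IsAlgebraic F a := (Algebra.IsAlgebraic.isAlgebraic (R := ℚ) a).tower_top F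
  rw [← mem_toSubalgebra, adjoin_simple_toSubalgebra_of_isAlgebraic halg] at hmem
  exact exists_eq_sum_of_mem_adjoin hd ha hmem

/-- A lower bound for the absolute height of the elements of `F(a)` outside `F`, for `a` a `d`-th
root of a prime that is unramified in `F`. -/
theorem norm_le_two_mul_absMulHeight₁_sq {F : IntermediateField ℚ QBar} [NumberField F] {p d : ℕ}
    (hp : p.Prime) (hd : 0 < d) {a : QBar} (ha : a ^ d = (p : QBar))
    (hF : ∀ (N : IntermediateField ℚ QBar) [NumberField N] [IsGalois ℚ N], F ≤ N →
      ∀ Q : Ideal (𝓞 N), Q.IsPrime → (p : 𝓞 N) ∈ Q → ∀ σ ∈ Q.inertia Gal(N/ℚ),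
      ∀ x (hx : x ∈ N), x ∈ F → σ ⟨x, hx⟩ = ⟨x, hx⟩)
    {γ : QBar} (hγ : γ ∈ F ⊔ adjoin ℚ {a}) (hγF : γ ∉ F) :
    ‖(a : ℂ)‖ ≤ 2 * absMulHeight₁ γ ^ 2 := by
  have : FiniteDimensional ℚ (adjoin ℚ {a}) :=
    adjoin.finiteDimensional (Algebra.IsIntegral.isIntegral a)
  have : FiniteDimensional ℚ (F ⊔ adjoin ℚ {a} : IntermediateField ℚ QBar) :=
    finiteDimensional_sup F (adjoin ℚ {a})
  let N : IntermediateField ℚ QBar :=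
    normalClosure ℚ (F ⊔ adjoin ℚ {a} : IntermediateField ℚ QBar) QBar
  have hle : F ⊔ adjoin ℚ {a} ≤ N := le_normalClosure _
  have : NumberField N := {}
  have : Normal ℚ N := normalClosure.normal ℚ _ QBar
  have : IsGalois ℚ N := ⟨⟩
  have hFN : F ≤ N := le_sup_left.trans hle
  have haN : a ∈ N := hle (le_sup_right (a := F) (mem_adjoin_simple_self ℚ a))
  obtain ⟨c, hc⟩ := exists_eq_sum_of_mem_sup_adjoin hd ha hγ
  let E : IntermediateField ℚ N := restrict hFN
  have hE (x : N) : x ∈ E ↔ (x : QBar) ∈ F := mem_restrict hFN x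
  let a' : N := ⟨a, haN⟩
  let c' (k : ℕ) : N := ⟨c k, hFN (c k).2⟩
  have hsum : ((∑ k ∈ Finset.range d, c' k * a' ^ k : N) : QBar) = γ := by
    rw [hc]
    simp [c', a']
  have hr : ‖(a : ℂ)‖ ^ d = p := by
    rw [← norm_pow]
    have := congr_arg (fun x : QBar ↦ ‖(x : ℂ)‖) ha
    simpa using this
  have key := pow_finrank_le_mulHeight₁ E hp hd (a := a') (Subtype.ext ha) (norm_nonneg (a : ℂ)) hr
    (fun w hw σ hσ ↦ ?_) (c := c') (fun k ↦ (hE _).mpr (c k).2) ?_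
  -- Every factor is now an `[N : ℚ]`-th power, so the root can be taken and the auxiliary `N`
  -- disappears.
  · rw [← absMulHeight₁_pow_finrank (N.val : N →+* QBar), ← pow_mul, mul_comm _ 2, pow_mul,
      ← mul_pow] at key
    have h := le_of_pow_le_pow_left₀ (Module.finrank_pos.ne') (by positivity) key
    rwa [show (N.val : N →+* QBar) (∑ k ∈ Finset.range d, c' k * a' ^ k) = γ from hsum] at h
  · rw [_root_.mem_fixingSubgroup_iff]
    intro x hx
    refine hF N hFN w.maximalIdeal.asIdeal w.maximalIdeal.isPrime ?_ σ hσ x x.2 ((hE x).mp hx)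
    rw [← FinitePlace.norm_lt_one_iff_mem N, FinitePlace.norm_embedding_eq]
    simpa using hw
  · rw [hE, hsum]
    exact hγF

/-- The set of elements of bounded absolute height in a number field is finite. -/
theorem finite_absMulHeight₁_le (F : IntermediateField ℚ QBar) [NumberField F] (X : ℝ) :
    {x : QBar | x ∈ F ∧ absMulHeight₁ x ≤ X}.Finite := by
  refine ((finite_setOfPred_mulHeight₁_le F (X ^ Module.finrank ℚ F)).image F.val).subset ?_
  rintro x ⟨hx, hX⟩
  refine ⟨⟨x, hx⟩, ?_, rfl⟩
  change Height.mulHeight₁ (⟨x, hx⟩ : F) ≤ X ^ Module.finrank ℚ F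
  rw [← absMulHeight₁_pow_finrank (F.val : F →+* QBar)]
  exact pow_le_pow_left₀ (absMulHeight₁_nonneg _) hX _

/-- The absolute height of a root of a positive integer is its modulus. -/
theorem absMulHeight₁_eq_norm {a : QBar} {n d : ℕ} (hn : 0 < n) (hd : 0 < d)
    (ha : a ^ d = (n : QBar)) : absMulHeight₁ a = ‖(a : ℂ)‖ := by
  have hr : ‖(a : ℂ)‖ ^ d = n := by
    rw [← norm_pow]
    have := congr_arg (fun x : QBar ↦ ‖(x : ℂ)‖) ha
    simpa using this
  have : FiniteDimensional ℚ (adjoin ℚ {a}) :=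
    adjoin.finiteDimensional (Algebra.IsIntegral.isIntegral a)
  have : NumberField (adjoin ℚ {a}) := {}
  have h1 := absMulHeight₁_pow_finrank ((adjoin ℚ {a}).val : adjoin ℚ {a} →+* QBar)
    (AdjoinSimple.gen ℚ a)
  have h2 : Height.mulHeight₁ (AdjoinSimple.gen ℚ a) ^ d =
      (n : ℝ) ^ Module.finrank ℚ (adjoin ℚ {a}) := by
    have : NeZero n := ⟨hn.ne'⟩
    rw [← Height.mulHeight₁_pow, ← Rat.mulHeight₁_natCast n, ← mulHeight₁_algebraMap]
    congr 1
    apply Subtype.ext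
    simpa using ha
  rw [← h1, ← hr, ← pow_mul, ← pow_mul, mul_comm d] at h2
  exact (pow_left_inj₀ (absMulHeight₁_nonneg _) (norm_nonneg _)
    (mul_pos Module.finrank_pos hd).ne').mp h2

/-! ### The equivalence -/

theorem corollary1p5
    (K : IntermediateField ℚ QBar) [NumberField K]
    (p : ℕ → ℕ) (hp : ∀ i, (p i).Prime) (hp_mono : StrictMono p)
    (d : ℕ → ℕ) (hd : ∀ i, 0 < d i)
    (α : ℕ → QBar) (hα : ∀ i, α i ^ d i = (p i : QBar)) :
    NorthcottProperty (IntermediateField.adjoin K (Set.range α) : Set QBar) ↔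
      Filter.Tendsto (fun i => ‖(α i : ℂ)‖) Filter.atTop Filter.atTop := by
  have hr (i : ℕ) : ‖(α i : ℂ)‖ ^ d i = p i := by
    rw [← norm_pow]
    have := congr_arg (fun x : QBar ↦ ‖(x : ℂ)‖) (hα i)
    simpa using this
  constructor
  · intro hN
    have hinj : Function.Injective α := by
      intro i j hij
      have h1 : p i ^ d j = p j ^ d i := by
        have : (p i : QBar) ^ d j = (p j : QBar) ^ d i := by
          rw [← hα i, ← hα j, hij, ← pow_mul, ← pow_mul, mul_comm]
        exact_mod_cast this
      have h2 : p i ∣ p j := (hp i).dvd_of_dvd_pow (h1 ▸ dvd_pow_self _ (hd j).ne')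
      exact hp_mono.injective ((Nat.prime_dvd_prime_iff_eq (hp i) (hp j)).mp h2)
    rw [← Nat.cofinite_eq_atTop, Filter.tendsto_atTop]
    intro X
    rw [Filter.eventually_cofinite]
    refine ((hN (max X 1) (by positivity)).preimage hinj.injOn).subset fun i hi ↦ ?_
    refine ⟨subset_adjoin K _ ⟨i, rfl⟩, ?_⟩
    rw [absMulHeight₁_eq_norm (hp i).pos (hd i) (hα i)]
    exact (not_le.mp hi).le.trans (le_max_left _ _)
  · intro hlim X hX
    obtain ⟨B, hB⟩ := exists_inertia_fixes_adjunctionTower K hd hα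
    -- The threshold 2 gives `2 ^ d j ≤ p j`, hence `d j < p j`, so that later primes are coprime to
    -- `d j`.
    obtain ⟨i₀, hi₀⟩ := Filter.eventually_atTop.mp (hlim.eventually_ge_atTop 2)
    obtain ⟨i₁, hi₁⟩ := Filter.eventually_atTop.mp (hlim.eventually_gt_atTop (2 * X ^ 2))
    have hdp (j : ℕ) (hj : i₀ ≤ j) : d j < p j := by
      have h1 : (2 : ℝ) ^ d j ≤ p j := by
        rw [← hr j]
        exact pow_le_pow_left₀ zero_le_two (hi₀ j hj) _
      exact (Nat.lt_two_pow_self).trans_le (by exact_mod_cast h1)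
    -- Since `m ≤ i ≤ p i`, the term `B + 1` gives `B < p i`, the sum gives `d j < p i` for the
    -- finitely many `j < i₀`, and `i₁` makes `‖α i‖` exceed `2 * X ^ 2`.
    let m := max i₁ (B + 1 + ∑ j ∈ Finset.range i₀, d j)
    have hmem (i : ℕ) (hi : m ≤ i) {γ : QBar} (hγ : γ ∈ adjunctionTower K α (i + 1))
        (hX : absMulHeight₁ γ ≤ X) : γ ∈ adjunctionTower K α i := by
      by_contra hγi
      have hip : i ≤ p i := hp_mono.le_apply
      have hBi : B < p i := by omega
      have hcop (j : ℕ) (hj : j < i) : (p i).Coprime (p j) ∧ (p i).Coprime (d j) := by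
        have hpj := hp_mono hj
        refine ⟨(Nat.coprime_primes (hp i) (hp j)).mpr hpj.ne',
          Nat.coprime_of_lt_prime (hd j).ne' ?_ (hp i)⟩
        rcases lt_or_ge j i₀ with h | h
        · have := Finset.single_le_sum (f := d) (fun _ _ ↦ Nat.zero_le _) (Finset.mem_range.mpr h)
          omega
        · exact (hdp j h).trans hpj
      have h1 := norm_le_two_mul_absMulHeight₁_sq (hp i) (hd i) (hα i)
        (hB (p i) (hp i) hBi i hcop) hγ hγi
      have h2 := hi₁ i ((le_max_left _ _).trans hi)
      have h3 := pow_le_pow_left₀ (absMulHeight₁_nonneg γ) hX 2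
      linarith
    refine (finite_absMulHeight₁_le (adjunctionTower K α m) X).subset ?_
    rintro γ ⟨hγ, hγX⟩
    refine ⟨?_, hγX⟩
    obtain ⟨i, hi⟩ := adjunctionTower.exists_mem K α hγ
    -- Bounded height lets `γ` descend the tower one stage at a time down to stage `m`.
    have hdesc (k : ℕ) (hk : γ ∈ adjunctionTower K α (m + k)) : γ ∈ adjunctionTower K α m := by
      induction k with
      | zero => exact hk
      | succ k ih => exact ih (hmem (m + k) (Nat.le_add_right m k) hk hγX)
    exact hdesc i (adjunctionTower.monotone K α (Nat.le_add_left i m) hi)
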